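/- Consider $n$ parties with Hilbert space $\mathcal H=\bigotimes_{i=1}^n\mathbb C^{d_i}$ (for instance $d_i=d$ for all $i$). Write $\psi$ also for the projector $|\psi\rangle\langle\psi|$ of a unit vector $|\psi\rangle\in\mathcal H$. Fidelity: $F(\rho,\sigma)=\bigl(\operatorname{tr}\sqrt{\sqrt\rho\,\sigma\sqrt\rho}\bigr)^2$ and $F_{LU}(\rho,\sigma)=\max_U F(\rho,U\sigma U^\dagger)$, the maximum being over local unitaries $U=\bigotimes_i U_i$. For an ensemble, $F_{av}(\{(p_i,\sigma_i)\},\phi)=\sum_i p_i F_{LU}(\sigma_i,\phi)$. LOCC: in each round of a protocol one party performs a measurement with finitely many outcomes $M_a$, $\sum_a M_a^\dagger M_a=1$, and announces the outcome; the party and the measurement may depend on all previous outcomes. A protocol with finitely many rounds, together with a classical label $i\in\{1,\dots,m\}$ for each of its branches, implements the map $\rho\mapsto\sum_i\bigl(\sum_{b\text{ with label }i}K_b\rho K_b^\dagger\bigr)\otimes|i\rangle\langle i|$, where $K_b$ is the product of the measurement operators along the branch $b$. A linear map $\Lambda$ is in LOCC if it is the limit in diamond norm of maps implemented in this way by protocols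 $P_0,P_1,\dots$ such that $P_r$ has (at most) $r$ rounds and the first $r$ rounds of $P_{r+1}$ are $P_r$. Let $T_{ens}(\psi)$ be the set of LOCC maps $\Lambda$ with $\Lambda(\psi)=\sum_{i=1}^m p_i\,|\phi_i\rangle\langle\phi_i|\otimes|i\rangle\langle i|$ for some finite ensemble $\{(p_i,|\phi_i\rangle)\}_{i=1}^m$ of pure states (also written $\Lambda(\psi)=\{(p_i,|\phi_i\rangle)\}$), and let $T_{ens-SLOCC}(\psi)$ be the set of those for which all $|\phi_i\rangle$ can be chosen SLOCC equivalent to $|\psi\rangle$, that is, $|\phi_i\rangle=(g_1\otimes\dots\otimes g_n)|\psi\rangle$ with invertible $g_k$. For $X\in\{ens,\ ens\text{-}SLOCC\}$ put $$F_X^\delta(\psi\to\phi)=\max_{\tilde\psi:\ F_{LU}(\psi,\tilde\psi)\ge 1-\delta}\ \ \sup_{\Lambda\in T_X(\tilde\psi)}F_{av}(\Lambda(\tilde\psi),\phi),$$ where $\tilde\psi$ ranges over pure states in $\mathcal H$. **Theorem.** For all pure states $|\psi\rangle,|\phi\rangle\in\mathcal H$ and every $\delta\ge 0$, the maxima over $\tilde\psi$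 in these definitions are attained, and $$F_{ens}^\delta(\psi\to\phi)=F_{ens-SLOCC}^\delta(\psi\to\phi).$$ -/

import Mathlib

open scoped MatrixOrder ComplexOrder

noncomputable section

namespace LOCC

/-! ## Fidelity, trace norm and diamond norm -/

/-- Trace norm `‖A‖₁ = tr √(Aᴴ A)`. -/
def traceNorm {ι : Type} [Fintype ι] [DecidableEq ι] (A : Matrix ι ι ℂ) : ℝ :=
  (CFC.sqrt (A.conjTranspose * A)).trace.re

/-- Fidelity `F(ρ, σ) = (tr √(√ρ σ √ρ))²`. -/
def fidelity {ι : Type} [Fintype ι] [DecidableEq ι] (ρ σ : Matrix ι ι ℂ) : ℝ :=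
  ((CFC.sqrt (CFC.sqrt ρ * σ * CFC.sqrt ρ)).trace.re) ^ 2

/-- The operator `(Φ ⊗ id_k)(X)`, where `Φ` acts on the first tensor factor of `X`. -/
def ampliation {ι κ : Type} (Φ : Matrix ι ι ℂ →ₗ[ℂ] Matrix κ κ ℂ) (k : ℕ)
    (X : Matrix (ι × Fin k) (ι × Fin k) ℂ) : Matrix (κ × Fin k) (κ × Fin k) ℂ :=
  Matrix.of fun a b => Φ (Matrix.of fun i j => X (i, a.2) (j, b.2)) a.1 b.1

/-- Diamond norm: the supremum of `‖(Φ ⊗ id_k)(X)‖₁` over all ancilla dimensions `k` and all `X`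
with `‖X‖₁ ≤ 1`, as an element of `[0, ∞]`. -/
def diamondNorm {ι κ : Type} [Fintype ι] [DecidableEq ι] [Fintype κ] [DecidableEq κ]
    (Φ : Matrix ι ι ℂ →ₗ[ℂ] Matrix κ κ ℂ) : ENNReal :=
  ⨆ (k : ℕ) (X : Matrix (ι × Fin k) (ι × Fin k) ℂ) (_ : traceNorm X ≤ 1),
    ENNReal.ofReal (traceNorm (ampliation Φ k X))

/-! ## Systems of `n` parties with local dimensions `d 0, …, d (n - 1)` -/

/-- Labels of the product basis of `⨂ i, ℂ^(d i)`. -/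
abbrev Idx {n : ℕ} (d : Fin n → ℕ) : Type := ∀ i, Fin (d i)

/-- Vectors of `⨂ i, ℂ^(d i)`, in coordinates with respect to the product basis. -/
abbrev Ket {n : ℕ} (d : Fin n → ℕ) : Type := Idx d → ℂ

/-- Operators on `⨂ i, ℂ^(d i)`. -/
abbrev Op {n : ℕ} (d : Fin n → ℕ) : Type := Matrix (Idx d) (Idx d) ℂ

/-- `ψ` is normalised. -/
def IsPureState {n : ℕ} {d : Fin n → ℕ} (ψ : Ket d) : Prop := star ψ ⬝ᵥ ψ = 1

/-- The operator `|ψ⟩⟨ψ|`. -/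
def proj {n : ℕ} {d : Fin n → ℕ} (ψ : Ket d) : Op d := Matrix.vecMulVec ψ (star ψ)

/-- The product operator `⨂ i, A i`. -/
def tensorOp {n : ℕ} {d : Fin n → ℕ} (A : ∀ i, Matrix (Fin (d i)) (Fin (d i)) ℂ) : Op d :=
  Matrix.of fun x y => ∏ i, A i (x i) (y i)

/-- The operator `A` of party `k`, acting as the identity on all the other parties. -/
def localOp {n : ℕ} {d : Fin n → ℕ} (k : Fin n) (A : Matrix (Fin (d k)) (Fin (d k)) ℂ) : Op d :=
  tensorOp (Function.update (fun _ => 1) k A)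

/-- The fidelity optimised over local unitaries, `max_U F(ρ, U σ Uᴴ)`. -/
def fidelityLU {n : ℕ} {d : Fin n → ℕ} (ρ σ : Op d) : ℝ :=
  ⨆ U : ∀ i, Matrix.unitaryGroup (Fin (d i)) ℂ,
    fidelity ρ (tensorOp (fun i => (U i : Matrix (Fin (d i)) (Fin (d i)) ℂ)) * σ *
      (tensorOp (fun i => (U i : Matrix (Fin (d i)) (Fin (d i)) ℂ))).conjTranspose)

/-- SLOCC equivalence: the two vectors are related by an invertible product operator. -/
def SLOCCEquiv {n : ℕ} {d : Fin n → ℕ} (ψ χ : Ket d) : Prop :=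
  ∃ g : ∀ i, GL (Fin (d i)) ℂ,
    ψ = (tensorOp (fun i => (g i : Matrix (Fin (d i)) (Fin (d i)) ℂ))).mulVec χ

/-! ## LOCC protocols -/

/-- A measurement with finitely many outcomes, performed by one party. -/
structure LocalMeasurement {n : ℕ} (d : Fin n → ℕ) where
  /-- The party that measures. -/
  party : Fin n
  /-- The number of outcomes. -/
  outcomes : ℕ
  /-- The measurement operators. -/
  kraus : Fin outcomes → Matrix (Fin (d party)) (Fin (d party)) ℂ
  /-- The completeness relation. -/
  complete : ∑ a, (kraus a).conjTranspose * kraus a = 1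

/-- Protocols with finitely many rounds. In each round one party measures and broadcasts the
outcome; who measures next, and what, may depend on all the outcomes so far. -/
inductive Protocol {n : ℕ} (d : Fin n → ℕ) : Type
  | halt : Protocol d
  | measure (M : LocalMeasurement d) (next : Fin M.outcomes → Protocol d) : Protocol d

namespace Protocol

/-- The (maximal) number of rounds. -/
def rounds {n : ℕ} {d : Fin n → ℕ} : Protocol d → ℕ
  | halt => 0
  | measure _ next => (Finset.univ.sup fun a => (next a).rounds) + 1

/-- The first `r` rounds of a protocol. -/
def truncate {n : ℕ} {d : Fin n → ℕ} : ℕ → Protocol d → Protocol d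
  | 0, _ => halt
  | _ + 1, halt => halt
  | r + 1, measure M next => measure M fun a => (next a).truncate r

/-- The branches of a protocol: the complete sequences of measurement outcomes. -/
def Branch {n : ℕ} {d : Fin n → ℕ} : Protocol d → Type
  | halt => Unit
  | measure M next => Σ a : Fin M.outcomes, (next a).Branch

/-- There are finitely many branches. -/
instance fintypeBranch {n : ℕ} {d : Fin n → ℕ} : (P : Protocol d) → Fintype P.Branch
  | halt => inferInstanceAs (Fintype Unit)
  | measure M next =>
    have : ∀ a, Fintype (next a).Branch := fun a => fintypeBranch (next a)
    inferInstanceAs (Fintype (Σ a : Fin M.outcomes, (next a).Branch))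

/-- The product of the measurement operators along a branch. -/
def branchOp {n : ℕ} {d : Fin n → ℕ} : (P : Protocol d) → P.Branch → Op d
  | halt, _ => 1
  | measure M next, ⟨a, b⟩ => (next a).branchOp b * localOp M.party (M.kraus a)

/-- The map `ρ ↦ ∑ j, (∑_{b : label b = j} K_b ρ K_bᴴ) ⊗ |j⟩⟨j|` implemented by a protocol, where
`K_b` is the operator of the branch `b` and only `label b` is kept as the final classical record. -/
def channel {n : ℕ} {d : Fin n → ℕ} (P : Protocol d) {m : ℕ} (label : P.Branch → Fin m) :
    Op d →ₗ[ℂ] Matrix (Idx d × Fin m) (Idx d × Fin m) ℂ where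
  toFun ρ := Matrix.blockDiagonal fun j =>
    ∑ b, if label b = j then P.branchOp b * ρ * (P.branchOp b).conjTranspose else 0
  map_add' ρ σ := by
    rw [← Matrix.blockDiagonal_add]
    congr 1
    funext j
    rw [Pi.add_apply, ← Finset.sum_add_distrib]
    refine Finset.sum_congr rfl fun b _ => ?_
    split_ifs
    · rw [mul_add, add_mul]
    · rw [add_zero]
  map_smul' c ρ := by
    rw [RingHom.id_apply, ← Matrix.blockDiagonal_smul]
    congr 1
    funext j
    rw [Pi.smul_apply, Finset.smul_sum]
    refine Finset.sum_congr rfl fun b _ => ?_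
    split_ifs
    · rw [mul_smul_comm, smul_mul_assoc]
    · rw [smul_zero]

end Protocol

/-! ## LOCC maps and ensemble transformations -/

/-- A linear map from operators on `⨂ i, ℂ^(d i)` to operators on `(⨂ i, ℂ^(d i)) ⊗ ℂ^m`, the last
factor being a classical register with finitely many values. -/
structure Transformation {n : ℕ} (d : Fin n → ℕ) where
  /-- The number of values of the register. -/
  m : ℕ
  /-- The map. -/
  map : Op d →ₗ[ℂ] Matrix (Idx d × Fin m) (Idx d × Fin m) ℂ

namespace Transformation

/-- LOCC maps, with possibly infinitely many rounds: limits in diamond norm of maps implemented by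
protocols `P 0, P 1, …`, where `P r` has (at most) `r` rounds and these are the first `r` rounds
of `P (r + 1)`. -/
def IsLOCC {n : ℕ} {d : Fin n → ℕ} (Λ : Transformation d) : Prop :=
  ∃ (P : ℕ → Protocol d) (label : ∀ r, (P r).Branch → Fin Λ.m),
    (∀ r, (P r).rounds ≤ r) ∧
    (∀ r, (P (r + 1)).truncate r = P r) ∧
    Filter.Tendsto (fun r => diamondNorm ((P r).channel (label r) - Λ.map))
      Filter.atTop (nhds 0)

/-- `Λ(|ψ⟩⟨ψ|) = ∑ i, p i • |χ i⟩⟨χ i| ⊗ |i⟩⟨i|`, where `{(p i, χ i)}` is an ensemble of pure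
states. -/
def Yields {n : ℕ} {d : Fin n → ℕ} (Λ : Transformation d) (ψ : Ket d)
    (p : Fin Λ.m → ℝ) (χ : Fin Λ.m → Ket d) : Prop :=
  (∀ i, 0 ≤ p i) ∧ ∑ i, p i = 1 ∧ (∀ i, IsPureState (χ i)) ∧
    Λ.map (proj ψ) = Matrix.blockDiagonal fun i => p i • proj (χ i)

end Transformation

/-- LOCC transformations of `ψ` into a finite ensemble of pure states. -/
def TEns {n : ℕ} {d : Fin n → ℕ} (ψ : Ket d) : Set (Transformation d) :=
  {Λ | Λ.IsLOCC ∧ ∃ p χ, Λ.Yields ψ p χ}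

/-- LOCC transformations of `ψ` into a finite ensemble of pure states that are all SLOCC equivalent
to `ψ`. -/
def TEnsSLOCC {n : ℕ} {d : Fin n → ℕ} (ψ : Ket d) : Set (Transformation d) :=
  {Λ | Λ ∈ TEns ψ ∧ ∃ p χ, Λ.Yields ψ p χ ∧ ∀ i, SLOCCEquiv (χ i) ψ}

/-! ## Optimal fidelities -/

/-- The average LU-optimised fidelity of the ensemble `{(p i, σ i)}` with `φ`. -/
def averageFidelity {n : ℕ} {d : Fin n → ℕ} {m : ℕ} (p : Fin m → ℝ) (σ : Fin m → Op d)
    (φ : Ket d) : ℝ :=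
  ∑ i, p i * fidelityLU (σ i) (proj φ)

/-- `sup_{Λ ∈ T ψ} F_av(Λ(ψ), φ)`, for a type `T` of transformations. -/
def optimalFidelityFrom {n : ℕ} {d : Fin n → ℕ} (T : Ket d → Set (Transformation d))
    (ψ φ : Ket d) : ℝ :=
  sSup {x | ∃ Λ ∈ T ψ, ∃ p χ, Λ.Yields ψ p χ ∧ x = averageFidelity p (fun i => proj (χ i)) φ}

/-- The pure states `ψ'` with `F_LU(ψ, ψ') ≥ 1 - δ`. -/
def vicinity {n : ℕ} {d : Fin n → ℕ} (δ : ℝ) (ψ : Ket d) : Set (Ket d) :=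
  {ψ' | IsPureState ψ' ∧ 1 - δ ≤ fidelityLU (proj ψ) (proj ψ')}

/-- The numbers `sup_{Λ ∈ T ψ'} F_av(Λ(ψ'), φ)` for `ψ'` in the `δ`-vicinity of `ψ`. -/
def fidelityValues {n : ℕ} {d : Fin n → ℕ} (T : Ket d → Set (Transformation d)) (δ : ℝ)
    (ψ φ : Ket d) : Set ℝ :=
  (fun ψ' => optimalFidelityFrom T ψ' φ) '' vicinity δ ψ

/-- The optimal fidelity `F_T^δ(ψ → φ) = max_{ψ' in the δ-vicinity} sup_{Λ ∈ T ψ'} F_av(Λ(ψ'), φ)`. -/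
def optimalFidelity {n : ℕ} {d : Fin n → ℕ} (T : Ket d → Set (Transformation d)) (δ : ℝ)
    (ψ φ : Ket d) : ℝ :=
  sSup (fidelityValues T δ ψ φ)

end LOCC

end

noncomputable section

namespace LOCC

/-! ## Squared norms -/

section SquaredNorm

variable {ι : Type*} [Fintype ι]

/-! For each fixed initial state `v`, both suprema over transformations equal `protocolFidelity φ
v`: the supremum over finite protocols of the sum, over branches `b`, of the overlap of `φ` with the
unnormalised branch vector `K_b v` (`optimalFidelityFrom_eq`). The squared overlap is homogeneous of
degree two, so a branch vector carries its own probability.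

Upper bound (`averageFidelity_le_protocolFidelity`): once a local unitary is fixed for each label,
the fidelity is linear in the output, so it passes to the limit defining an LOCC map; merging
branches under one label cannot help, since separate branches could choose separate unitaries.

Lower bound (`Protocol.exists_isInvertible_lt_value`, `exists_mem_TEnsSLOCC`): every measurement can
be perturbed to one with invertible operators, at the price of one extra outcome, also invertible,
after which the protocol halts. All branch operators are then invertible product operators, so all
final states stay in the SLOCC class, and by continuity the value drops arbitrarily little.

Attainment: the value of a protocol behaves like a squared seminorm dominated by the Euclidean one
(`IsGauge`). This passes to the supremum over protocols and forces continuity, and the vicinity is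
compact. -/

/-- The squared Euclidean norm of a complex vector. -/
def normSq (v : ι → ℂ) : ℝ := ∑ i, ‖v i‖ ^ 2

lemma star_dotProduct_self (v : ι → ℂ) : star v ⬝ᵥ v = (normSq v : ℂ) := by
  simp only [dotProduct, normSq, Pi.star_apply, RCLike.star_def, Complex.conj_mul',
    Complex.ofReal_sum, Complex.ofReal_pow]

lemma normSq_nonneg (v : ι → ℂ) : 0 ≤ normSq v := Finset.sum_nonneg fun _ _ => by positivity

lemma normSq_smul (c : ℂ) (v : ι → ℂ) : normSq (c • v) = ‖c‖ ^ 2 * normSq v := by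
  simp only [normSq, Pi.smul_apply, smul_eq_mul, norm_mul, mul_pow, Finset.mul_sum]

lemma normSq_pos {v : ι → ℂ} (hv : v ≠ 0) : 0 < normSq v := by
  obtain ⟨i, hi⟩ := Function.ne_iff.1 hv
  refine Finset.sum_pos' (fun _ _ => by positivity) ⟨i, Finset.mem_univ i, ?_⟩
  have : 0 < ‖v i‖ := norm_pos_iff.2 hi
  positivity

lemma continuous_normSq : Continuous (normSq : (ι → ℂ) → ℝ) := by
  unfold normSq
  fun_prop

lemma normSq_neg (v : ι → ℂ) : normSq (-v) = normSq v := by simp [normSq]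

/-- The cross term is split by AM-GM with a free weight `t`. For fixed `t` the bound is linear in
the squared norms, which is why it survives sums over coordinates and outcomes as well as suprema.
-/
lemma norm_add_sq_le {E : Type*} [SeminormedAddCommGroup E] (a b : E) {t : ℝ} (ht : 0 < t) :
    ‖a + b‖ ^ 2 ≤ (1 + t) * ‖a‖ ^ 2 + (1 + t⁻¹) * ‖b‖ ^ 2 := by
  have h1 : ‖a + b‖ ^ 2 ≤ (‖a‖ + ‖b‖) ^ 2 := by
    gcongr
    exact norm_add_le a b
  have h2 : t * ‖a‖ ^ 2 + t⁻¹ * ‖b‖ ^ 2 - 2 * ‖a‖ * ‖b‖ = t⁻¹ * (t * ‖a‖ - ‖b‖) ^ 2 := by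
    field_simp
    ring
  have h3 : 0 ≤ t⁻¹ * (t * ‖a‖ - ‖b‖) ^ 2 := by positivity
  nlinarith

lemma normSq_add_le (v w : ι → ℂ) {t : ℝ} (ht : 0 < t) :
    normSq (v + w) ≤ (1 + t) * normSq v + (1 + t⁻¹) * normSq w := by
  simp only [normSq, Finset.mul_sum, ← Finset.sum_add_distrib]
  exact Finset.sum_le_sum fun i _ => norm_add_sq_le _ _ ht

lemma norm_dotProduct_sq_le (v w : ι → ℂ) : ‖star v ⬝ᵥ w‖ ^ 2 ≤ normSq v * normSq w := by
  have h : ‖star v ⬝ᵥ w‖ ≤ ∑ i, ‖v i‖ * ‖w i‖ := by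
    refine (norm_sum_le _ _).trans (le_of_eq (Finset.sum_congr rfl fun i _ => ?_))
    simp
  calc ‖star v ⬝ᵥ w‖ ^ 2 ≤ (∑ i, ‖v i‖ * ‖w i‖) ^ 2 := by gcongr
    _ ≤ _ := Finset.sum_mul_sq_le_sq_mul_sq _ _ _

lemma normSq_mulVec {κ : Type*} [Fintype κ] (A : Matrix κ ι ℂ) (v : ι → ℂ) :
    ((normSq (A.mulVec v) : ℝ) : ℂ) = star v ⬝ᵥ (A.conjTranspose * A).mulVec v := by
  rw [← star_dotProduct_self, Matrix.star_mulVec, ← Matrix.dotProduct_mulVec, Matrix.mulVec_mulVec]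

lemma sum_normSq_mulVec [DecidableEq ι] {κ : Type*} [Fintype κ] {α : Type*} [Fintype α]
    {A : α → Matrix κ ι ℂ} (hA : ∑ a, (A a).conjTranspose * A a = 1) (v : ι → ℂ) :
    ∑ a, normSq ((A a).mulVec v) = normSq v := by
  have h : ((∑ a, normSq ((A a).mulVec v) : ℝ) : ℂ) = normSq v := by
    rw [Complex.ofReal_sum]
    simp only [normSq_mulVec]
    rw [← dotProduct_sum, ← Matrix.sum_mulVec, hA, Matrix.one_mulVec, star_dotProduct_self]
  exact_mod_cast h

end SquaredNorm

/-! ## Gauges -/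

/-- Nonnegative functions on vectors which satisfy the inequalities of the square of a seminorm
that is dominated by the Euclidean norm. -/
structure IsGauge {ι : Type*} [Fintype ι] (q : (ι → ℂ) → ℝ) : Prop where
  nonneg : ∀ v, 0 ≤ q v
  le_normSq : ∀ v, q v ≤ normSq v
  add_le : ∀ v w (t : ℝ), 0 < t → q (v + w) ≤ (1 + t) * q v + (1 + t⁻¹) * q w

namespace IsGauge

variable {ι : Type*} [Fintype ι] {q : (ι → ℂ) → ℝ}

lemma sub_le (hq : IsGauge q) (v w : ι → ℂ) :
    q v - q w ≤ √(normSq (v - w)) * normSq w + √(normSq (v - w)) + normSq (v - w) := by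
  by_cases h : v = w
  · subst h
    have := normSq_nonneg v
    simp [normSq]
  · have hp : 0 < normSq (v - w) := normSq_pos (sub_ne_zero.2 h)
    set s := √(normSq (v - w)) with hs
    have hs0 : 0 < s := Real.sqrt_pos.2 hp
    have hss : normSq (v - w) = s ^ 2 := (Real.sq_sqrt hp.le).symm
    -- Taking `t` to be the Euclidean norm of `v - w` makes both error terms vanish as `v` tends to
    -- `w`, with a modulus independent of `q`.
    have h1 := hq.add_le w (v - w) s hs0
    rw [add_sub_cancel] at h1
    have h2 : (1 + s⁻¹) * q (v - w) ≤ (1 + s⁻¹) * s ^ 2 := by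
      rw [← hss]
      gcongr
      exact hq.le_normSq _
    have h3 : (1 + s⁻¹) * s ^ 2 = s ^ 2 + s := by field_simp
    have h4 : s * q w ≤ s * normSq w := by
      gcongr
      exact hq.le_normSq _
    rw [hss]
    linarith

lemma continuous (hq : IsGauge q) : Continuous q := by
  rw [continuous_iff_continuousAt]
  intro w
  rw [ContinuousAt, tendsto_iff_dist_tendsto_zero]
  have hc := continuous_normSq (ι := ι)
  have hlim : Filter.Tendsto (fun v => √(normSq (v - w)) * (normSq v + normSq w) +
      √(normSq (v - w)) + normSq (v - w)) (nhds w) (nhds 0) := by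
    have : Continuous fun v => √(normSq (v - w)) * (normSq v + normSq w) +
      √(normSq (v - w)) + normSq (v - w) := by fun_prop
    refine (this.tendsto w).trans (le_of_eq ?_)
    simp [normSq]
  refine squeeze_zero (fun _ => dist_nonneg) (fun v => ?_) hlim
  have h1 := hq.sub_le v w
  have h2 := hq.sub_le w v
  rw [← neg_sub v w, normSq_neg] at h2
  have h3 : 0 ≤ √(normSq (v - w)) * normSq w := mul_nonneg (Real.sqrt_nonneg _) (normSq_nonneg _)
  have h4 : 0 ≤ √(normSq (v - w)) * normSq v := mul_nonneg (Real.sqrt_nonneg _) (normSq_nonneg _)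
  rw [Real.dist_eq, abs_le]
  constructor <;> linarith

/-- Completeness of the measurement enters only in the domination by `normSq`; the other two
properties hold termwise. -/
lemma sum_comp [DecidableEq ι] {κ : Type*} [Fintype κ] {α : Type*} [Fintype α]
    {q : α → (κ → ℂ) → ℝ} (hq : ∀ a, IsGauge (q a)) {A : α → Matrix κ ι ℂ}
    (hA : ∑ a, (A a).conjTranspose * A a = 1) :
    IsGauge fun v => ∑ a, q a ((A a).mulVec v) where
  nonneg v := Finset.sum_nonneg fun a _ => (hq a).nonneg _
  le_normSq v := by
    rw [← sum_normSq_mulVec hA v]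
    exact Finset.sum_le_sum fun a _ => (hq a).le_normSq _
  add_le v w t ht := by
    simp only [Finset.mul_sum, ← Finset.sum_add_distrib, Matrix.mulVec_add]
    exact Finset.sum_le_sum fun a _ => (hq a).add_le _ _ t ht

/-- Real suprema of unbounded families default to `0`; domination by `normSq` rules this out. -/
lemma bddAbove_range {α : Sort*} {q : α → (ι → ℂ) → ℝ} (hq : ∀ a, IsGauge (q a)) (v : ι → ℂ) :
    BddAbove (Set.range fun a => q a v) :=
  ⟨normSq v, by rintro _ ⟨a, rfl⟩; exact (hq a).le_normSq v⟩

lemma iSup {α : Sort*} [Nonempty α] {q : α → (ι → ℂ) → ℝ} (hq : ∀ a, IsGauge (q a)) :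
    IsGauge fun v => ⨆ a, q a v where
  nonneg v := Real.iSup_nonneg fun a => (hq a).nonneg v
  le_normSq v := ciSup_le fun a => (hq a).le_normSq v
  add_le v w t ht := by
    refine ciSup_le fun a => ((hq a).add_le v w t ht).trans ?_
    gcongr
    · exact le_ciSup (bddAbove_range hq v) a
    · exact le_ciSup (bddAbove_range hq w) a

end IsGauge

lemma isGauge_norm_dotProduct_sq {ι : Type*} [Fintype ι] {u : ι → ℂ} (hu : normSq u = 1) :
    IsGauge fun v => ‖star v ⬝ᵥ u‖ ^ 2 where
  nonneg _ := by positivity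
  le_normSq v := by simpa [hu] using norm_dotProduct_sq_le v u
  add_le v w t ht := by
    rw [star_add, add_dotProduct]
    exact norm_add_sq_le _ _ ht

/-! ## Trace norm and fidelity -/

section TraceNorm

variable {ι : Type} [Fintype ι] [DecidableEq ι]

/-- Write `|A| = CᴴC`, so that the trace norm is the sum of the squared column norms of `C`. Since
`|A|² = AᴴA`, corresponding columns of `A` and `|A|` have equal norms, and the entries of `|A|` are
inner products of columns of `C`, to which Cauchy-Schwarz applies. -/
lemma norm_apply_le_traceNorm (A : Matrix ι ι ℂ) (i j : ι) : ‖A i j‖ ≤ traceNorm A := by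
  obtain ⟨C, hC⟩ : ∃ C : Matrix ι ι ℂ, CFC.sqrt (A.conjTranspose * A) = C.conjTranspose * C := by
    obtain ⟨C, hC⟩ := CStarAlgebra.nonneg_iff_eq_star_mul_self.1
      (CFC.sqrt_nonneg (A.conjTranspose * A))
    exact ⟨C, hC⟩
  have hsq : (C.conjTranspose * C) * (C.conjTranspose * C) = A.conjTranspose * A := by
    rw [← hC]
    exact CFC.sqrt_mul_sqrt_self _ (Matrix.posSemidef_conjTranspose_mul_self A).nonneg
  have hcol (B : Matrix ι ι ℂ) (k l : ι) :
      (B.conjTranspose * B) k l = star (fun x => B x k) ⬝ᵥ fun x => B x l := by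
    simp [Matrix.mul_apply, dotProduct]
  set g : ι → ℝ := fun k => normSq fun x => C x k with hg
  have hg0 : ∀ k, 0 ≤ g k := fun k => normSq_nonneg _
  have htr : traceNorm A = ∑ k, g k := by
    have h : ((∑ k, g k : ℝ) : ℂ) = (C.conjTranspose * C).trace := by
      simp only [Matrix.trace, Matrix.diag, hcol, star_dotProduct_self, Complex.ofReal_sum, hg]
    rw [traceNorm, hC, ← h, Complex.ofReal_re]
  have hAj : normSq (fun x => A x j) = ∑ k, ‖(C.conjTranspose * C) k j‖ ^ 2 := by
    have h1 : ((normSq (fun x => A x j) : ℝ) : ℂ) =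
        ((normSq (fun k => (C.conjTranspose * C) k j) : ℝ) : ℂ) := by
      rw [← star_dotProduct_self, ← star_dotProduct_self, ← hcol, ← hcol, ← hsq,
        Matrix.conjTranspose_mul, Matrix.conjTranspose_conjTranspose]
    exact_mod_cast h1
  have hle : ‖A i j‖ ^ 2 ≤ (∑ k, g k) ^ 2 := by
    calc ‖A i j‖ ^ 2 ≤ normSq (fun x => A x j) :=
          Finset.single_le_sum (f := fun x => ‖A x j‖ ^ 2) (fun _ _ => by positivity)
            (Finset.mem_univ i)
      _ = ∑ k, ‖(C.conjTranspose * C) k j‖ ^ 2 := hAj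
      _ ≤ ∑ k, g k * g j := by
          refine Finset.sum_le_sum fun k _ => ?_
          rw [hcol]
          exact norm_dotProduct_sq_le _ _
      _ = (∑ k, g k) * g j := by rw [Finset.sum_mul]
      _ ≤ (∑ k, g k) * ∑ k, g k := by
          gcongr
          · exact Finset.sum_nonneg fun k _ => hg0 k
          · exact Finset.single_le_sum (fun k _ => hg0 k) (Finset.mem_univ j)
      _ = _ := (sq _).symm
  rw [htr]
  exact le_of_sq_le_sq hle (Finset.sum_nonneg fun k _ => hg0 k)

lemma traceNorm_of_isHermitian_of_isIdempotentElem {A : Matrix ι ι ℂ}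
    (hA : A.conjTranspose = A) (hA' : A * A = A) : traceNorm A = A.trace.re := by
  have h0 : 0 ≤ A := by
    have := (Matrix.posSemidef_conjTranspose_mul_self A).nonneg
    rwa [hA, hA'] at this
  rw [traceNorm, hA, CFC.sqrt_mul_self A h0]

/-- The projector `ρ` on `v` is its own square root, and `ρσρ = c²ρ = (cρ)²` with `c = |⟨v, w⟩|`, so
the outer root is `cρ`, of trace `c`. -/
lemma fidelity_vecMulVec {v : ι → ℂ} (hv : normSq v = 1) (w : ι → ℂ) :
    fidelity (Matrix.vecMulVec v (star v)) (Matrix.vecMulVec w (star w)) =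
      ‖star v ⬝ᵥ w‖ ^ 2 := by
  have hpos : 0 ≤ Matrix.vecMulVec v (star v) := (Matrix.posSemidef_vecMulVec_self_star v).nonneg
  have hvv : star v ⬝ᵥ v = 1 := by rw [star_dotProduct_self, hv, Complex.ofReal_one]
  have hidem : Matrix.vecMulVec v (star v) * Matrix.vecMulVec v (star v) =
      Matrix.vecMulVec v (star v) := by
    rw [Matrix.vecMulVec_mul_vecMulVec, hvv, one_smul]
  have hsqrt : CFC.sqrt (Matrix.vecMulVec v (star v)) = Matrix.vecMulVec v (star v) :=
    CFC.sqrt_unique hidem hpos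
  set c : ℝ := ‖star v ⬝ᵥ w‖ with hc
  have hcc : (star v ⬝ᵥ w) * (star w ⬝ᵥ v) = ((c ^ 2 : ℝ) : ℂ) := by
    have : star w ⬝ᵥ v = star (star v ⬝ᵥ w) := by
      rw [Matrix.star_dotProduct]
    rw [this, RCLike.star_def, Complex.mul_conj', hc]
    push_cast
    rfl
  have hprod : Matrix.vecMulVec v (star v) * Matrix.vecMulVec w (star w) *
      Matrix.vecMulVec v (star v) = ((c : ℂ) • Matrix.vecMulVec v (star v)) *
        ((c : ℂ) • Matrix.vecMulVec v (star v)) := by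
    rw [smul_mul_smul_comm, hidem, Matrix.vecMulVec_mul_vecMulVec,
      Matrix.vecMulVec_mul_vecMulVec, smul_dotProduct]
    ext i j
    simp only [Matrix.smul_apply, Matrix.vecMulVec_apply, Pi.smul_apply, smul_eq_mul]
    have := hcc
    push_cast at this
    linear_combination (v i * star v j) * this
  have hpos' : 0 ≤ (c : ℂ) • Matrix.vecMulVec v (star v) := by
    refine (Matrix.PosSemidef.smul (Matrix.posSemidef_vecMulVec_self_star v) ?_).nonneg
    exact_mod_cast norm_nonneg _
  rw [fidelity, hsqrt, hprod, CFC.sqrt_mul_self _ hpos', Matrix.trace_smul,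
    Matrix.trace_vecMulVec, dotProduct_comm, hvv]
  simp

end TraceNorm

/-! ## Product operators -/

section ProductOperators

variable {n : ℕ} {d : Fin n → ℕ}

lemma tensorOp_mul (A B : ∀ i, Matrix (Fin (d i)) (Fin (d i)) ℂ) :
    tensorOp A * tensorOp B = tensorOp fun i => A i * B i := by
  ext x z
  simp only [tensorOp, Matrix.mul_apply, Matrix.of_apply, Finset.prod_univ_sum,
    Fintype.piFinset_univ, Finset.prod_mul_distrib]

lemma tensorOp_one : tensorOp (fun i => (1 : Matrix (Fin (d i)) (Fin (d i)) ℂ)) = 1 := by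
  ext x y
  simp only [tensorOp, Matrix.of_apply]
  by_cases h : x = y
  · subst h
    simp
  · obtain ⟨i, hi⟩ := Function.ne_iff.1 h
    rw [Matrix.one_apply_ne h]
    exact Finset.prod_eq_zero (Finset.mem_univ i) (Matrix.one_apply_ne hi)

lemma conjTranspose_tensorOp (A : ∀ i, Matrix (Fin (d i)) (Fin (d i)) ℂ) :
    (tensorOp A).conjTranspose = tensorOp fun i => (A i).conjTranspose := by
  ext x y
  simp [tensorOp, Matrix.conjTranspose_apply]

lemma localOp_apply (k : Fin n) (A : Matrix (Fin (d k)) (Fin (d k)) ℂ) (x y : Idx d) :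
    localOp k A x y = A (x k) (y k) *
      ∏ i ∈ Finset.univ.erase k, (1 : Matrix (Fin (d i)) (Fin (d i)) ℂ) (x i) (y i) := by
  rw [localOp, tensorOp, Matrix.of_apply, ← Finset.mul_prod_erase _ _ (Finset.mem_univ k),
    Function.update_self]
  congr 1
  refine Finset.prod_congr rfl fun i hi => ?_
  rw [Function.update_of_ne (Finset.ne_of_mem_erase hi)]

lemma localOp_one (k : Fin n) : localOp (d := d) k 1 = 1 := by
  rw [localOp, Function.update_eq_self_iff.2 rfl, tensorOp_one]

lemma localOp_mul (k : Fin n) (A B : Matrix (Fin (d k)) (Fin (d k)) ℂ) :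
    localOp k A * localOp k B = localOp k (A * B) := by
  rw [localOp, localOp, localOp, tensorOp_mul]
  congr 1
  funext i
  by_cases h : i = k
  · subst h
    simp
  · simp [Function.update_of_ne h]

lemma conjTranspose_localOp (k : Fin n) (A : Matrix (Fin (d k)) (Fin (d k)) ℂ) :
    (localOp k A).conjTranspose = localOp k A.conjTranspose := by
  rw [localOp, localOp, conjTranspose_tensorOp]
  congr 1
  funext i
  by_cases h : i = k
  · subst h
    simp
  · simp [Function.update_of_ne h]

lemma localOp_sum (k : Fin n) {α : Type*} (s : Finset α)
    (A : α → Matrix (Fin (d k)) (Fin (d k)) ℂ) :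
    localOp k (∑ a ∈ s, A a) = ∑ a ∈ s, localOp k (A a) := by
  ext x y
  simp only [localOp_apply, Matrix.sum_apply, Finset.sum_mul]

lemma continuous_localOp (k : Fin n) :
    Continuous (localOp k : Matrix (Fin (d k)) (Fin (d k)) ℂ → Op d) := by
  refine continuous_matrix fun x y => ?_
  simp only [localOp_apply]
  fun_prop

lemma LocalMeasurement.sum_localOp (M : LocalMeasurement d) :
    ∑ a, (localOp M.party (M.kraus a)).conjTranspose * localOp M.party (M.kraus a) = 1 := by
  simp only [conjTranspose_localOp, localOp_mul]
  rw [← localOp_sum, M.complete, localOp_one]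

/-- The product operator of a family of local unitaries. -/
abbrev unitaryOp (U : ∀ i, Matrix.unitaryGroup (Fin (d i)) ℂ) : Op d :=
  tensorOp fun i => (U i : Matrix (Fin (d i)) (Fin (d i)) ℂ)

lemma unitaryOp_one : unitaryOp (1 : ∀ i, Matrix.unitaryGroup (Fin (d i)) ℂ) = 1 :=
  tensorOp_one

lemma conjTranspose_unitaryOp_mul_self (U : ∀ i, Matrix.unitaryGroup (Fin (d i)) ℂ) :
    (unitaryOp U).conjTranspose * unitaryOp U = 1 := by
  rw [conjTranspose_tensorOp, tensorOp_mul]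
  convert tensorOp_one using 2
  funext i
  exact Matrix.UnitaryGroup.star_mul_self (U i)

lemma normSq_unitaryOp_mulVec (U : ∀ i, Matrix.unitaryGroup (Fin (d i)) ℂ) (v : Ket d) :
    normSq ((unitaryOp U).mulVec v) = normSq v := by
  have h := normSq_mulVec (unitaryOp U) v
  rw [conjTranspose_unitaryOp_mul_self, Matrix.one_mulVec, star_dotProduct_self] at h
  exact_mod_cast h

lemma mul_proj_mul (A : Op d) (v : Ket d) :
    A * proj v * A.conjTranspose = proj (A.mulVec v) := by
  rw [proj, proj, Matrix.mul_vecMulVec, Matrix.vecMulVec_mul, Matrix.star_mulVec]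

lemma proj_smul (c : ℂ) (v : Ket d) : proj (c • v) = ((‖c‖ ^ 2 : ℝ) : ℂ) • proj v := by
  ext i j
  have := Complex.mul_conj' c
  simp only [proj, Matrix.vecMulVec_apply, Pi.smul_apply, Pi.star_apply, smul_eq_mul,
    Matrix.smul_apply, star_mul', RCLike.star_def, Complex.ofReal_pow]
  linear_combination (v i * (starRingEnd ℂ) (v j)) * this

lemma star_dotProduct_proj_mulVec (u v : Ket d) :
    star u ⬝ᵥ (proj v).mulVec u = ((‖star v ⬝ᵥ u‖ ^ 2 : ℝ) : ℂ) := by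
  have h : star u ⬝ᵥ v = star (star v ⬝ᵥ u) := by rw [Matrix.star_dotProduct]
  rw [proj, Matrix.vecMulVec_mulVec, dotProduct_smul, h]
  simp [Complex.conj_mul']

lemma isPureState_iff (v : Ket d) : IsPureState v ↔ normSq v = 1 := by
  rw [IsPureState, star_dotProduct_self]
  exact_mod_cast Iff.rfl

end ProductOperators

/-! ## Overlaps optimised over local unitaries -/

section Overlap

variable {n : ℕ} {d : Fin n → ℕ}

/-- The squared overlap of two vectors, optimised over local unitaries. -/
def overlap (w v : Ket d) : ℝ :=
  ⨆ U : ∀ i, Matrix.unitaryGroup (Fin (d i)) ℂ, ‖star v ⬝ᵥ (unitaryOp U).mulVec w‖ ^ 2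

lemma isGauge_unitary_overlap {w : Ket d} (hw : normSq w = 1)
    (U : ∀ i, Matrix.unitaryGroup (Fin (d i)) ℂ) :
    IsGauge fun v => ‖star v ⬝ᵥ (unitaryOp U).mulVec w‖ ^ 2 :=
  isGauge_norm_dotProduct_sq ((normSq_unitaryOp_mulVec U w).trans hw)

lemma isGauge_overlap {w : Ket d} (hw : normSq w = 1) : IsGauge (overlap w) :=
  IsGauge.iSup (isGauge_unitary_overlap hw)

lemma le_overlap {w : Ket d} (hw : normSq w = 1) (v : Ket d)
    (U : ∀ i, Matrix.unitaryGroup (Fin (d i)) ℂ) :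
    ‖star v ⬝ᵥ (unitaryOp U).mulVec w‖ ^ 2 ≤ overlap w v :=
  le_ciSup (IsGauge.bddAbove_range (isGauge_unitary_overlap hw) v) U

lemma overlap_smul (w v : Ket d) (c : ℂ) : overlap w (c • v) = ‖c‖ ^ 2 * overlap w v := by
  rw [overlap, overlap, Real.mul_iSup_of_nonneg (by positivity)]
  simp [star_smul, smul_dotProduct, mul_pow]

/-- Moving `U` to the other vector replaces it by its inverse. This turns the condition defining the
vicinity into one on a gauge, hence on a continuous function. -/
lemma overlap_comm (w v : Ket d) : overlap w v = overlap v w := by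
  rw [overlap, overlap]
  refine (Equiv.inv (∀ i, Matrix.unitaryGroup (Fin (d i)) ℂ)).iSup_congr fun U => ?_
  have h : unitaryOp (U⁻¹) = (unitaryOp U).conjTranspose := by
    rw [conjTranspose_tensorOp]
    rfl
  rw [Equiv.inv_apply, h, ← norm_star (star v ⬝ᵥ _), Matrix.star_dotProduct, Matrix.star_mulVec,
    Matrix.conjTranspose_conjTranspose, ← Matrix.dotProduct_mulVec]

lemma overlap_self {v : Ket d} (hv : normSq v = 1) : 1 ≤ overlap v v := by
  have h := le_overlap hv v 1
  rwa [unitaryOp_one, Matrix.one_mulVec, star_dotProduct_self, hv, Complex.ofReal_one, norm_one,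
    one_pow] at h

lemma fidelityLU_proj {v : Ket d} (hv : IsPureState v) (w : Ket d) :
    fidelityLU (proj v) (proj w) = overlap w v := by
  rw [isPureState_iff] at hv
  rw [fidelityLU, overlap]
  refine iSup_congr fun U => ?_
  rw [mul_proj_mul]
  exact fidelity_vecMulVec hv _

end Overlap

/-! ## Invertible perturbations of measurements -/

section Perturbation

variable {ι : Type} [Fintype ι] [DecidableEq ι]

/-- The spectrum is finite, so `-ε` avoids it for all small `ε > 0`. -/
lemma eventually_isUnit_add_smul_one (M : Matrix ι ι ℂ) :
    ∀ᶠ ε : ℝ in nhdsWithin 0 (Set.Ioi 0), IsUnit (M + (ε : ℂ) • (1 : Matrix ι ι ℂ)) := by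
  have hlim : Filter.Tendsto (fun ε : ℝ => -(ε : ℂ)) (nhdsWithin 0 (Set.Ioi 0))
      (nhdsWithin 0 {0}ᶜ) := by
    refine tendsto_nhdsWithin_iff.2 ⟨?_, ?_⟩
    · have : Continuous fun ε : ℝ => -(ε : ℂ) := by fun_prop
      simpa using (this.tendsto 0).mono_left nhdsWithin_le_nhds
    · filter_upwards [self_mem_nhdsWithin] with ε hε
      simpa using (Set.mem_Ioi.1 hε).ne'
  have hfin : ∀ᶠ z in nhdsWithin (0 : ℂ) {0}ᶜ, z ∉ spectrum ℂ M :=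
    nhdsNE_le_cofinite 0 (M.finite_spectrum.compl_mem_cofinite)
  filter_upwards [hlim.eventually hfin] with ε hε
  have h := (spectrum.notMem_iff.1 hε).neg
  have h2 : -(algebraMap ℂ (Matrix ι ι ℂ) (-(ε : ℂ)) - M) = M + (ε : ℂ) • 1 := by
    rw [Algebra.algebraMap_eq_smul_one, neg_smul]
    abel
  rwa [h2] at h

lemma exists_isUnit_conjTranspose_mul_self_of_posDef {A : Matrix ι ι ℂ} (hA : A.PosDef) :
    ∃ R : Matrix ι ι ℂ, IsUnit R ∧ R.conjTranspose * R = A := by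
  obtain ⟨R, hR⟩ := CStarAlgebra.nonneg_iff_eq_star_mul_self.1 hA.posSemidef.nonneg
  refine ⟨R, ?_, hR.symm⟩
  have h := (Matrix.isUnit_iff_isUnit_det _).1 hA.isUnit
  rw [hR, Matrix.det_mul] at h
  exact (Matrix.isUnit_iff_isUnit_det _).2 (isUnit_of_mul_isUnit_right h)

lemma exists_isUnit_perturbation {α : Type*} [Fintype α] (M : α → Matrix ι ι ℂ)
    (hM : ∑ a, (M a).conjTranspose * M a = 1) :
    ∃ N : ℝ → α → Matrix ι ι ℂ,
      (∀ a, Filter.Tendsto (fun ε => N ε a) (nhdsWithin 0 (Set.Ioi 0)) (nhds (M a))) ∧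
      ∀ᶠ ε in nhdsWithin (0 : ℝ) (Set.Ioi 0), (∀ a, IsUnit (N ε a)) ∧
        ∃ R : Matrix ι ι ℂ, IsUnit R ∧
          R.conjTranspose * R + ∑ a, (N ε a).conjTranspose * N ε a = 1 := by
  obtain ⟨k, hk⟩ : ∃ k : ℝ, k = Fintype.card α := ⟨_, rfl⟩
  -- With weight `t = ε`, the operators `M a + ε` satisfy `∑ ‖(M a + ε) x‖² ≤ (1 + ε + k (ε + ε²))
  -- ‖x‖²`. The additional `ε` in `f` makes the inequality strict after division by `f ε`, so the
  -- defect from completeness is positive definite and equals `RᴴR` with `R` invertible.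
  set f : ℝ → ℝ := fun ε => 1 + 2 * ε + k * (ε + ε ^ 2) with hf
  have hk0 : 0 ≤ k := hk ▸ Nat.cast_nonneg _
  have hf0 : f 0 = 1 := by simp [hf]
  refine ⟨fun ε a => (((√(f ε))⁻¹ : ℝ) : ℂ) • (M a + (ε : ℂ) • 1), fun a => ?_, ?_⟩
  · have h1 : ContinuousAt (fun ε : ℝ => (((√(f ε))⁻¹ : ℝ) : ℂ)) 0 := by
      refine Complex.continuous_ofReal.continuousAt.comp (ContinuousAt.inv₀ ?_ ?_)
      · have : Continuous fun ε => √(f ε) := by fun_prop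
        exact this.continuousAt
      · simp [hf0]
    have h2 : Continuous fun ε : ℝ => M a + (ε : ℂ) • (1 : Matrix ι ι ℂ) := by fun_prop
    have h3 := (h1.smul h2.continuousAt).tendsto.mono_left
      (nhdsWithin_le_nhds (s := Set.Ioi (0 : ℝ)))
    refine h3.trans (le_of_eq (congrArg nhds ?_))
    change (((√(f 0))⁻¹ : ℝ) : ℂ) • (M a + ((0 : ℝ) : ℂ) • (1 : Matrix ι ι ℂ)) = M a
    simp [hf0]
  · have hunit := (Filter.eventually_all (ι := α)).2
      fun a => eventually_isUnit_add_smul_one (M a)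
    filter_upwards [self_mem_nhdsWithin, hunit] with ε hε hu
    have hε : 0 < ε := hε
    have hfpos : 0 < f ε := by positivity
    have hs : 0 < (√(f ε))⁻¹ := inv_pos.2 (Real.sqrt_pos.2 hfpos)
    set s : ℝ := (√(f ε))⁻¹ with hsdef
    have hss : s ^ 2 * f ε = 1 := by
      rw [hsdef, inv_pow, Real.sq_sqrt hfpos.le, inv_mul_cancel₀ hfpos.ne']
    set N : α → Matrix ι ι ℂ := fun a => (s : ℂ) • (M a + (ε : ℂ) • 1) with hN
    refine ⟨fun a => ?_, ?_⟩
    · have hsu : IsUnit ((s : ℂ)) := (Complex.ofReal_ne_zero.2 hs.ne').isUnit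
      obtain ⟨u, hu'⟩ := hsu
      have := (hu a).smul u
      rwa [Units.smul_def, hu'] at this
    · have hherm : (∑ a, (N a).conjTranspose * N a).IsHermitian := by
        simp [Matrix.IsHermitian, Matrix.conjTranspose_sum, Matrix.conjTranspose_mul]
      have hpd : (1 - ∑ a, (N a).conjTranspose * N a).PosDef := by
        refine Matrix.PosDef.of_dotProduct_mulVec_pos (Matrix.isHermitian_one.sub hherm) ?_
        intro x hx
        have hx0 := normSq_pos hx
        rw [Matrix.sub_mulVec, Matrix.one_mulVec, Matrix.sum_mulVec, dotProduct_sub,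
          dotProduct_sum, star_dotProduct_self]
        simp only [← normSq_mulVec]
        have hle : ∑ a, normSq ((N a).mulVec x) ≤
            s ^ 2 * ((1 + ε) * normSq x + k * ((ε + ε ^ 2) * normSq x)) := by
          have hterm a : normSq ((N a).mulVec x) ≤
              s ^ 2 * ((1 + ε) * normSq ((M a).mulVec x) + (ε + ε ^ 2) * normSq x) := by
            rw [hN, Matrix.smul_mulVec, normSq_smul, Matrix.add_mulVec, Matrix.smul_mulVec,
              Matrix.one_mulVec, Complex.norm_real, Real.norm_eq_abs, sq_abs]
            gcongr
            refine (normSq_add_le _ _ hε).trans (le_of_eq ?_)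
            rw [normSq_smul, Complex.norm_real, Real.norm_eq_abs, sq_abs]
            field_simp
            ring
          refine (Finset.sum_le_sum fun a _ => hterm a).trans (le_of_eq ?_)
          rw [← Finset.mul_sum, Finset.sum_add_distrib, ← Finset.mul_sum, sum_normSq_mulVec hM,
            Finset.sum_const, nsmul_eq_mul, Finset.card_univ, ← hk]
        have hpos : 0 < normSq x - ∑ a, normSq ((N a).mulVec x) := by
          have h1 : normSq x = s ^ 2 * f ε * normSq x := by rw [hss, one_mul]
          have h2 : 0 < s ^ 2 * ε * normSq x := by positivity
          have h3 : s ^ 2 * f ε * normSq x =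
              s ^ 2 * ((1 + ε) * normSq x + k * ((ε + ε ^ 2) * normSq x)) +
                s ^ 2 * ε * normSq x := by
            simp only [hf]
            ring
          linarith
        exact_mod_cast hpos
      obtain ⟨R, hR, hRR⟩ := exists_isUnit_conjTranspose_mul_self_of_posDef hpd
      exact ⟨R, hR, by rw [hRR]; exact sub_add_cancel _ _⟩

end Perturbation

/-! ## The value of a protocol -/

namespace Protocol

variable {n : ℕ} {d : Fin n → ℕ}

/-- The sum of `q` over the unnormalised final states of the branches of a protocol. -/
def value (q : Ket d → ℝ) : Protocol d → Ket d → ℝ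
  | halt, v => q v
  | measure M next, v => ∑ a, (next a).value q ((localOp M.party (M.kraus a)).mulVec v)

lemma value_eq_sum_branch (q : Ket d → ℝ) (P : Protocol d) (v : Ket d) :
    P.value q v = ∑ b, q ((P.branchOp b).mulVec v) := by
  induction P generalizing v with
  | halt =>
    change q v = ∑ b : Unit, q ((1 : Op d).mulVec v)
    simp
  | measure M next ih =>
    rw [value]
    simp only [ih]
    change _ = ∑ b : (Σ a : Fin M.outcomes, (next a).Branch), q
      (((next b.1).branchOp b.2 * localOp M.party (M.kraus b.1)).mulVec v)
    rw [Fintype.sum_sigma]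
    simp only [Matrix.mulVec_mulVec]

lemma isGauge_value {q : Ket d → ℝ} (hq : IsGauge q) (P : Protocol d) : IsGauge (P.value q) := by
  induction P with
  | halt => exact hq
  | measure M next ih => exact IsGauge.sum_comp ih M.sum_localOp

lemma value_normSq (P : Protocol d) (v : Ket d) : P.value normSq v = normSq v := by
  induction P generalizing v with
  | halt => rfl
  | measure M next ih =>
    rw [value]
    simp only [ih]
    exact sum_normSq_mulVec M.sum_localOp v

/-- All measurement operators are invertible. -/
def IsInvertible : Protocol d → Prop
  | halt => True
  | measure M next => (∀ a, IsUnit (M.kraus a)) ∧ ∀ a, (next a).IsInvertible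

lemma IsInvertible.exists_branchOp_eq {P : Protocol d} (hP : P.IsInvertible) (b : P.Branch) :
    ∃ g : ∀ i, GL (Fin (d i)) ℂ,
      P.branchOp b = tensorOp fun i => (g i : Matrix (Fin (d i)) (Fin (d i)) ℂ) := by
  induction P with
  | halt => exact ⟨fun _ => 1, tensorOp_one.symm⟩
  | measure M next ih =>
    obtain ⟨a, b⟩ := b
    obtain ⟨g, hg⟩ := ih a (hP.2 a) b
    obtain ⟨u, hu⟩ := hP.1 a
    refine ⟨fun i => g i * Function.update (fun i => (1 : GL (Fin (d i)) ℂ)) M.party u i, ?_⟩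
    change (next a).branchOp b * localOp M.party (M.kraus a) = _
    rw [hg, localOp, tensorOp_mul]
    congr 1
    funext i
    by_cases h : i = M.party
    · subst h
      simp [hu]
    · simp [Function.update_of_ne h]

/-- The continuations are replaced before the current measurement is perturbed: with them fixed, the
value is continuous in the measurement operators. The extra outcome only adds a nonnegative term. -/
lemma exists_isInvertible_lt_value {q : Ket d → ℝ} (hq : IsGauge q) (P : Protocol d) (v : Ket d)
    {c : ℝ} (hc : c < P.value q v) : ∃ P' : Protocol d, P'.IsInvertible ∧ c < P'.value q v := by
  induction P generalizing v c with
  | halt => exact ⟨halt, trivial, hc⟩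
  | measure M next ih =>
    set x : Fin M.outcomes → ℝ :=
      fun a => (next a).value q ((localOp M.party (M.kraus a)).mulVec v) with hx
    have hc : c < ∑ a, x a := hc
    -- The slack is shared among the outcomes; the `+ 1` leaves one share over, keeping the
    -- inequality strict, and covers the case of no outcomes.
    set e : ℝ := (∑ a, x a - c) / (M.outcomes + 1) with he
    have he0 : 0 < e := div_pos (sub_pos.2 hc) (by positivity)
    have hstep a : ∃ P' : Protocol d, P'.IsInvertible ∧
        x a - e < P'.value q ((localOp M.party (M.kraus a)).mulVec v) :=
      ih a _ (sub_lt_self _ he0)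
    choose P' hinv hlt using hstep
    obtain ⟨N, hN, hev⟩ := exists_isUnit_perturbation M.kraus M.complete
    have hsum : c < ∑ a, (P' a).value q ((localOp M.party (M.kraus a)).mulVec v) := by
      have h1 : ∑ a, (x a - e) ≤ ∑ a, (P' a).value q ((localOp M.party (M.kraus a)).mulVec v) :=
        Finset.sum_le_sum fun a _ => (hlt a).le
      have h2 : (M.outcomes + 1) * e = ∑ a, x a - c := by
        rw [he]
        field_simp
      rw [Finset.sum_sub_distrib, Finset.sum_const, Finset.card_univ, Fintype.card_fin,
        nsmul_eq_mul] at h1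
      linarith
    have hlim : Filter.Tendsto
        (fun ε => ∑ a, (P' a).value q ((localOp M.party (N ε a)).mulVec v))
        (nhdsWithin 0 (Set.Ioi 0))
        (nhds (∑ a, (P' a).value q ((localOp M.party (M.kraus a)).mulVec v))) := by
      refine tendsto_finsetSum _ fun a _ => ?_
      have hcont : Continuous fun A : Matrix (Fin (d M.party)) (Fin (d M.party)) ℂ =>
          (P' a).value q ((localOp M.party A).mulVec v) :=
        (isGauge_value hq (P' a)).continuous.comp
          ((continuous_localOp M.party).matrix_mulVec continuous_const)
      exact (hcont.tendsto _).comp (hN a)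
    obtain ⟨ε, hε, hunit, R, hR, hcomplete⟩ := ((hlim.eventually_const_lt hsum).and hev).exists
    let M' : LocalMeasurement d :=
      { party := M.party
        outcomes := M.outcomes + 1
        kraus := Fin.cons R (N ε)
        complete := by
          rw [Fin.sum_univ_succ]
          simpa using hcomplete }
    refine ⟨measure M' (Fin.cons halt P' : Fin (M.outcomes + 1) → Protocol d), ⟨?_, ?_⟩, ?_⟩
    · exact Fin.cases hR hunit
    · exact Fin.cases trivial hinv
    · refine hε.trans_le ?_
      change _ ≤ ∑ a : Fin (M.outcomes + 1),
        ((Fin.cons halt P' : Fin (M.outcomes + 1) → Protocol d) a).value q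
          ((localOp M.party ((Fin.cons R (N ε) : Fin (M.outcomes + 1) → _) a)).mulVec v)
      rw [Fin.sum_univ_succ]
      simp only [Fin.cons_succ]
      exact le_add_of_nonneg_left ((isGauge_value hq _).nonneg _)

/-! ### Truncation -/

lemma rounds_truncate_le (r : ℕ) (P : Protocol d) : (P.truncate r).rounds ≤ r := by
  induction r generalizing P with
  | zero => simp [truncate, rounds]
  | succ r ih =>
    cases P with
    | halt => simp [truncate, rounds]
    | measure M next =>
      simp only [truncate, rounds, add_le_add_iff_right, Finset.sup_le_iff]
      exact fun a _ => ih _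

lemma truncate_truncate_succ (r : ℕ) (P : Protocol d) :
    (P.truncate (r + 1)).truncate r = P.truncate r := by
  induction r generalizing P with
  | zero => simp [truncate]
  | succ r ih =>
    cases P with
    | halt => simp [truncate]
    | measure M next =>
      rw [truncate, truncate, truncate]
      simp only [ih]

lemma truncate_of_rounds_le {r : ℕ} {P : Protocol d} (h : P.rounds ≤ r) : P.truncate r = P := by
  induction r generalizing P with
  | zero =>
    cases P with
    | halt => rfl
    | measure M next => simp [rounds] at h
  | succ r ih =>
    cases P with
    | halt => rfl
    | measure M next =>
      simp only [rounds, add_le_add_iff_right, Finset.sup_le_iff] at h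
      rw [truncate]
      congr 1
      funext a
      exact ih (h a (Finset.mem_univ a))

lemma channel_proj (P : Protocol d) {m : ℕ} (label : P.Branch → Fin m) (v : Ket d) :
    P.channel label (proj v) = Matrix.blockDiagonal fun j =>
      ∑ b, if label b = j then proj ((P.branchOp b).mulVec v) else 0 := by
  simp only [← mul_proj_mul]
  rfl

end Protocol

/-! ## Convergence in diamond norm -/

/-- An ancilla of dimension one suffices, so diamond-norm convergence gives entrywise convergence on
pure states. -/
lemma ofReal_norm_map_apply_le_diamondNorm {ι κ : Type} [Fintype ι] [DecidableEq ι] [Fintype κ]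
    [DecidableEq κ] (Φ : Matrix ι ι ℂ →ₗ[ℂ] Matrix κ κ ℂ) {v : ι → ℂ} (hv : normSq v = 1)
    (x y : κ) :
    ENNReal.ofReal ‖Φ (Matrix.vecMulVec v (star v)) x y‖ ≤ diamondNorm Φ := by
  set w : ι × Fin 1 → ℂ := fun a => v a.1 with hw
  have hw1 : star w ⬝ᵥ w = 1 := by
    have : normSq w = 1 := by
      rw [← hv, normSq, Fintype.sum_prod_type]
      simp [normSq, hw]
    rw [star_dotProduct_self, this, Complex.ofReal_one]
  set X : Matrix (ι × Fin 1) (ι × Fin 1) ℂ := Matrix.vecMulVec w (star w) with hX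
  have htr : traceNorm X ≤ 1 := by
    rw [traceNorm_of_isHermitian_of_isIdempotentElem, hX, Matrix.trace_vecMulVec, dotProduct_comm,
      hw1, Complex.one_re]
    · rw [hX, Matrix.conjTranspose_vecMulVec, star_star]
    · rw [hX, Matrix.vecMulVec_mul_vecMulVec, hw1, one_smul]
  calc ENNReal.ofReal ‖Φ (Matrix.vecMulVec v (star v)) x y‖
      = ENNReal.ofReal ‖ampliation Φ 1 X (x, 0) (y, 0)‖ := rfl
    _ ≤ ENNReal.ofReal (traceNorm (ampliation Φ 1 X)) :=
        ENNReal.ofReal_le_ofReal (norm_apply_le_traceNorm _ _ _)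
    _ ≤ diamondNorm Φ := by
        rw [diamondNorm]
        exact le_iSup_of_le 1 (le_iSup_of_le X (le_iSup_of_le htr le_rfl))

lemma tendsto_map_apply_of_tendsto_diamondNorm {ι κ : Type} [Fintype ι] [DecidableEq ι]
    [Fintype κ] [DecidableEq κ] {α : Type*} {l : Filter α}
    {Φ : α → Matrix ι ι ℂ →ₗ[ℂ] Matrix κ κ ℂ} {Ψ : Matrix ι ι ℂ →ₗ[ℂ] Matrix κ κ ℂ}
    (h : Filter.Tendsto (fun r => diamondNorm (Φ r - Ψ)) l (nhds 0))
    {v : ι → ℂ} (hv : normSq v = 1) (x y : κ) :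
    Filter.Tendsto (fun r => Φ r (Matrix.vecMulVec v (star v)) x y) l
      (nhds (Ψ (Matrix.vecMulVec v (star v)) x y)) := by
  rw [tendsto_iff_norm_sub_tendsto_zero]
  have h1 := tendsto_of_tendsto_of_tendsto_of_le_of_le tendsto_const_nhds h
    (fun _ => zero_le) fun r => ofReal_norm_map_apply_le_diamondNorm (Φ r - Ψ) hv x y
  have h2 := (ENNReal.tendsto_toReal ENNReal.zero_ne_top).comp h1
  refine h2.congr fun r => ?_
  simp

lemma diamondNorm_zero {ι κ : Type} [Fintype ι] [DecidableEq ι] [Fintype κ] [DecidableEq κ] :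
    diamondNorm (0 : Matrix ι ι ℂ →ₗ[ℂ] Matrix κ κ ℂ) = 0 := by
  have h (k : ℕ) (X : Matrix (ι × Fin k) (ι × Fin k) ℂ) :
      ampliation (0 : Matrix ι ι ℂ →ₗ[ℂ] Matrix κ κ ℂ) k X = 0 := by
    ext a b
    simp [ampliation]
  simp [diamondNorm, h, traceNorm]

/-! ## Optimal fidelities in terms of finite protocols -/

section Optimal

variable {n : ℕ} {d : Fin n → ℕ}

/-- The supremum over protocols with finitely many rounds of the sum over the branches of the
overlap with `φ`. -/
def protocolFidelity (φ v : Ket d) : ℝ := ⨆ P : Protocol d, P.value (overlap φ) v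

instance : Nonempty (Protocol d) := ⟨.halt⟩

lemma isGauge_protocolFidelity {φ : Ket d} (hφ : normSq φ = 1) : IsGauge (protocolFidelity φ) :=
  IsGauge.iSup fun P => P.isGauge_value (isGauge_overlap hφ)

lemma value_le_protocolFidelity {φ : Ket d} (hφ : normSq φ = 1) (P : Protocol d) (v : Ket d) :
    P.value (overlap φ) v ≤ protocolFidelity φ v :=
  le_ciSup (IsGauge.bddAbove_range (fun P => Protocol.isGauge_value (isGauge_overlap hφ) P) v) P

lemma averageFidelity_proj {m : ℕ} (p : Fin m → ℝ) {χ : Fin m → Ket d}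
    (hχ : ∀ i, IsPureState (χ i)) (φ : Ket d) :
    averageFidelity p (fun i => proj (χ i)) φ = ∑ i, p i * overlap φ (χ i) :=
  Finset.sum_congr rfl fun i _ => by rw [fidelityLU_proj (hχ i)]

/-- On the left all branches with the same label share a unitary; on the right each branch optimises
its own. -/
lemma sum_channel_block_le {φ : Ket d} (hφ : normSq φ = 1) (P : Protocol d) {m : ℕ}
    (label : P.Branch → Fin m) (v : Ket d)
    (U : Fin m → ∀ i, Matrix.unitaryGroup (Fin (d i)) ℂ) :
    ∑ j, (star ((unitaryOp (U j)).mulVec φ) ⬝ᵥ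
      (∑ b, if label b = j then proj ((P.branchOp b).mulVec v) else 0).mulVec
        ((unitaryOp (U j)).mulVec φ)).re ≤ P.value (overlap φ) v := by
  have h j : (star ((unitaryOp (U j)).mulVec φ) ⬝ᵥ
      (∑ b, if label b = j then proj ((P.branchOp b).mulVec v) else 0).mulVec
        ((unitaryOp (U j)).mulVec φ)).re ≤
      ∑ b, if label b = j then overlap φ ((P.branchOp b).mulVec v) else 0 := by
    rw [Matrix.sum_mulVec, dotProduct_sum, Complex.re_sum]
    refine Finset.sum_le_sum fun b _ => ?_
    split_ifs
    · rw [star_dotProduct_proj_mulVec, Complex.ofReal_re]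
      exact le_overlap hφ _ _
    · simp
  refine (Finset.sum_le_sum fun j _ => h j).trans (le_of_eq ?_)
  rw [Finset.sum_comm, Protocol.value_eq_sum_branch]
  simp

lemma averageFidelity_le_protocolFidelity {φ ψ : Ket d} (hφ : normSq φ = 1) (hψ : normSq ψ = 1)
    {Λ : Transformation d} (hΛ : Λ.IsLOCC) {p : Fin Λ.m → ℝ} {χ : Fin Λ.m → Ket d}
    (h : Λ.Yields ψ p χ) :
    averageFidelity p (fun i => proj (χ i)) φ ≤ protocolFidelity φ ψ := by
  obtain ⟨hp, hp1, hχ, hmap⟩ := h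
  obtain ⟨P, label, -, -, hlim⟩ := hΛ
  rw [averageFidelity_proj p hχ]
  refine le_of_forall_pos_le_add fun ε hε => ?_
  -- Near-optimal unitaries are fixed before the limit is taken; as the `p i` sum to one, the total
  -- loss is at most `ε`.
  have hU i : ∃ U : ∀ i, Matrix.unitaryGroup (Fin (d i)) ℂ,
      overlap φ (χ i) - ε < ‖star (χ i) ⬝ᵥ (unitaryOp U).mulVec φ‖ ^ 2 :=
    exists_lt_of_lt_ciSup (sub_lt_self _ hε)
  choose U hU using hU
  set u : Fin Λ.m → Ket d := fun i => (unitaryOp (U i)).mulVec φ with hu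
  have h1 : ∑ i, p i * overlap φ (χ i) ≤ ∑ i, p i * ‖star (χ i) ⬝ᵥ u i‖ ^ 2 + ε := by
    calc ∑ i, p i * overlap φ (χ i) ≤ ∑ i, (p i * ‖star (χ i) ⬝ᵥ u i‖ ^ 2 + p i * ε) := by
          refine Finset.sum_le_sum fun i _ => ?_
          rw [← mul_add]
          exact mul_le_mul_of_nonneg_left (sub_le_iff_le_add.1 (hU i).le) (hp i)
      _ = _ := by rw [Finset.sum_add_distrib, ← Finset.sum_mul, hp1, one_mul]
  have hblock i : Filter.Tendsto
      (fun r => ∑ b, if label r b = i then proj (((P r).branchOp b).mulVec ψ) else 0)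
      Filter.atTop (nhds (p i • proj (χ i))) := by
    refine tendsto_pi_nhds.2 fun x => tendsto_pi_nhds.2 fun y => ?_
    have := tendsto_map_apply_of_tendsto_diamondNorm hlim hψ (x, i) (y, i)
    change Filter.Tendsto (fun r => (P r).channel (label r) (proj ψ) (x, i) (y, i)) _
      (nhds (Λ.map (proj ψ) (x, i) (y, i))) at this
    simpa only [Protocol.channel_proj, hmap, Matrix.blockDiagonal_apply_eq] using this
  have hquad : Filter.Tendsto (fun r => ∑ i, (star (u i) ⬝ᵥ
      (∑ b, if label r b = i then proj (((P r).branchOp b).mulVec ψ) else 0).mulVec (u i)).re)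
      Filter.atTop (nhds (∑ i, p i * ‖star (χ i) ⬝ᵥ u i‖ ^ 2)) := by
    refine tendsto_finsetSum _ fun i _ => ?_
    have hcont : Continuous fun M : Op d => (star (u i) ⬝ᵥ M.mulVec (u i)).re := by fun_prop
    have hval : (star (u i) ⬝ᵥ (p i • proj (χ i)).mulVec (u i)).re =
        p i * ‖star (χ i) ⬝ᵥ u i‖ ^ 2 := by
      rw [Matrix.smul_mulVec, dotProduct_smul, star_dotProduct_proj_mulVec, Complex.real_smul,
        ← Complex.ofReal_mul, Complex.ofReal_re]
    rw [← hval]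
    exact (hcont.tendsto _).comp (hblock i)
  have h2 : ∑ i, p i * ‖star (χ i) ⬝ᵥ u i‖ ^ 2 ≤ protocolFidelity φ ψ :=
    le_of_tendsto' hquad fun r => (sum_channel_block_le hφ (P r) (label r) ψ U).trans
      (value_le_protocolFidelity hφ (P r) ψ)
  linarith

lemma isLOCC_channel (P : Protocol d) {m : ℕ} [Nonempty (Fin m)] (label : P.Branch → Fin m) :
    (⟨m, P.channel label⟩ : Transformation d).IsLOCC := by
  classical
  -- Labels are chosen for all protocols at once, so that `truncate r P = P` can be rewritten
  -- despite the dependent type. Labels of strict truncations are irrelevant to the limit.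
  obtain ⟨label', hlabel⟩ : ∃ label' : ∀ Q : Protocol d, Q.Branch → Fin m, label' P = label :=
    ⟨fun Q => if h : P = Q then h ▸ label else fun _ => Classical.arbitrary _, by simp⟩
  refine ⟨fun r => P.truncate r, fun r => label' _,
    fun r => P.rounds_truncate_le r, fun r => P.truncate_truncate_succ r, ?_⟩
  refine tendsto_const_nhds.congr' ?_
  filter_upwards [Filter.eventually_ge_atTop P.rounds] with r hr
  rw [Protocol.truncate_of_rounds_le hr, hlabel, sub_self, diamondNorm_zero]

lemma tensorOp_mulVec_ne_zero (g : ∀ i, GL (Fin (d i)) ℂ) {v : Ket d} (hv : v ≠ 0) :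
    (tensorOp fun i => (g i : Matrix (Fin (d i)) (Fin (d i)) ℂ)).mulVec v ≠ 0 := by
  intro h
  have hinv : (tensorOp fun i => ((g i)⁻¹ : GL (Fin (d i)) ℂ).val) *
      (tensorOp fun i => (g i : Matrix (Fin (d i)) (Fin (d i)) ℂ)) = 1 := by
    rw [tensorOp_mul]
    simp only [Units.inv_mul]
    exact tensorOp_one
  apply hv
  rw [← Matrix.one_mulVec v, ← hinv, ← Matrix.mulVec_mulVec, h, Matrix.mulVec_zero]

/-- The unit vector in the direction of `v`. -/
def normalize (v : Ket d) : Ket d := (((√(normSq v))⁻¹ : ℝ) : ℂ) • v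

lemma normSq_mul_norm_sq {v : Ket d} (hv : v ≠ 0) :
    normSq v * ‖(((√(normSq v))⁻¹ : ℝ) : ℂ)‖ ^ 2 = 1 := by
  have h := normSq_pos hv
  rw [Complex.norm_real, Real.norm_eq_abs, sq_abs, inv_pow, Real.sq_sqrt h.le,
    mul_inv_cancel₀ h.ne']

lemma isPureState_normalize {v : Ket d} (hv : v ≠ 0) : IsPureState (normalize v) := by
  rw [isPureState_iff, normalize, normSq_smul, mul_comm, normSq_mul_norm_sq hv]

lemma sloccEquiv_normalize {ψ : Ket d} (hψ : normSq ψ = 1) (g : ∀ i, GL (Fin (d i)) ℂ) :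
    SLOCCEquiv
      (normalize ((tensorOp fun i => (g i : Matrix (Fin (d i)) (Fin (d i)) ℂ)).mulVec ψ)) ψ := by
  have hψ0 : ψ ≠ 0 := by
    rintro rfl
    simp [normSq] at hψ
  have hv := normSq_pos (tensorOp_mulVec_ne_zero g hψ0)
  set v := (tensorOp fun i => (g i : Matrix (Fin (d i)) (Fin (d i)) ℂ)).mulVec ψ with hvdef
  -- The normalising scalar is absorbed into the operator of one party. Without parties, every
  -- product operator is `1` and the scalar is already `1`.
  rcases isEmpty_or_nonempty (Fin n) with hn | ⟨⟨k⟩⟩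
  · have hone (A : ∀ i, Matrix (Fin (d i)) (Fin (d i)) ℂ) : tensorOp A = 1 := by
      rw [← tensorOp_one]
      congr 1
      exact funext fun i => hn.elim i
    refine ⟨g, ?_⟩
    rw [← hvdef, normalize, hvdef, hone, Matrix.one_mulVec, hψ]
    simp
  · set c : ℂ := (((√(normSq v))⁻¹ : ℝ) : ℂ) with hc
    have hc0 : c ≠ 0 := Complex.ofReal_ne_zero.2 (inv_ne_zero (Real.sqrt_pos.2 hv).ne')
    obtain ⟨u, hu⟩ : IsUnit (c • (1 : Matrix (Fin (d k)) (Fin (d k)) ℂ)) :=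
      isUnit_one.smul (Units.mk0 c hc0)
    refine ⟨fun i => Function.update (fun i => (1 : GL (Fin (d i)) ℂ)) k u i * g i, ?_⟩
    have hlocal : localOp k (c • (1 : Matrix (Fin (d k)) (Fin (d k)) ℂ)) = c • (1 : Op d) := by
      rw [← localOp_one k]
      ext x y
      simp only [localOp_apply, Matrix.smul_apply, smul_eq_mul, mul_assoc]
    have hmul : tensorOp (fun i => ((Function.update (fun i => (1 : GL (Fin (d i)) ℂ)) k u i * g i :
        GL (Fin (d i)) ℂ) : Matrix (Fin (d i)) (Fin (d i)) ℂ)) =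
        localOp k (c • (1 : Matrix (Fin (d k)) (Fin (d k)) ℂ)) *
          tensorOp fun i => (g i : Matrix (Fin (d i)) (Fin (d i)) ℂ) := by
      rw [localOp, tensorOp_mul]
      congr 1
      funext i
      by_cases h : i = k
      · subst h
        simp [hu]
      · simp [Function.update_of_ne h]
    rw [hmul, hlocal, Matrix.smul_mul, Matrix.one_mul, Matrix.smul_mulVec, normalize]

/-- Giving each branch its own label keeps every block pure. Invertibility makes all branch vectors
nonzero, so each can be normalised, with its squared norm as probability. -/
lemma exists_mem_TEnsSLOCC {φ ψ : Ket d} (hψ : normSq ψ = 1) {P : Protocol d}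
    (hP : P.IsInvertible) :
    ∃ Λ ∈ TEnsSLOCC ψ, ∃ p χ, Λ.Yields ψ p χ ∧
      P.value (overlap φ) ψ = averageFidelity p (fun i => proj (χ i)) φ := by
  classical
  have hψ0 : ψ ≠ 0 := by
    rintro rfl
    simp [normSq] at hψ
  have hne (b : P.Branch) : (P.branchOp b).mulVec ψ ≠ 0 := by
    obtain ⟨g, hg⟩ := hP.exists_branchOp_eq b
    rw [hg]
    exact tensorOp_mulVec_ne_zero g hψ0
  have hsum : ∑ b, normSq ((P.branchOp b).mulVec ψ) = 1 := by
    rw [← Protocol.value_eq_sum_branch, Protocol.value_normSq, hψ]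
  set e := Fintype.equivFin P.Branch with he
  have : Nonempty P.Branch := by
    by_contra h
    rw [not_nonempty_iff] at h
    simp at hsum
  have : Nonempty (Fin (Fintype.card P.Branch)) := ⟨e (Classical.arbitrary _)⟩
  set K : Fin (Fintype.card P.Branch) → Ket d :=
    fun j => (P.branchOp (e.symm j)).mulVec ψ with hK
  have hK0 j : K j ≠ 0 := hne _
  set Λ : Transformation d := ⟨Fintype.card P.Branch, P.channel e⟩ with hΛ
  have hyields : Λ.Yields ψ (fun j => normSq (K j)) fun j => normalize (K j) := by
    refine ⟨fun j => normSq_nonneg _, ?_, fun j => isPureState_normalize (hK0 j), ?_⟩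
    · rw [← hsum]
      exact Equiv.sum_comp e.symm fun b => normSq ((P.branchOp b).mulVec ψ)
    · change P.channel e (proj ψ) = _
      rw [Protocol.channel_proj]
      congr 1
      funext j
      have h1 : (normSq (K j) : ℝ) • proj (normalize (K j)) = proj (K j) := by
        rw [normalize, proj_smul, ← Complex.coe_smul, smul_smul, ← Complex.ofReal_mul,
          normSq_mul_norm_sq (hK0 j), Complex.ofReal_one, one_smul]
      rw [h1]
      simp only [← Equiv.eq_symm_apply]
      rw [Finset.sum_ite_eq' Finset.univ (e.symm j), if_pos (Finset.mem_univ _)]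
  have hLOCC : Λ.IsLOCC := isLOCC_channel P e
  refine ⟨Λ, ⟨⟨hLOCC, _, _, hyields⟩, _, _, hyields, fun j => ?_⟩, _, _, hyields, ?_⟩
  · obtain ⟨g, hg⟩ := hP.exists_branchOp_eq (e.symm j)
    change SLOCCEquiv (normalize ((P.branchOp (e.symm j)).mulVec ψ)) ψ
    rw [hg]
    exact sloccEquiv_normalize hψ g
  · rw [averageFidelity_proj _ fun j => isPureState_normalize (hK0 j),
      Protocol.value_eq_sum_branch, ← Equiv.sum_comp e.symm]
    refine Finset.sum_congr rfl fun j _ => ?_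
    rw [normalize, overlap_smul, ← mul_assoc, normSq_mul_norm_sq (hK0 j), one_mul]

/-- Treating any `T` between the two classes handles both at once: the upper bound holds for the
larger, the approximating protocols lie in the smaller. -/
lemma optimalFidelityFrom_eq {φ ψ : Ket d} (hφ : normSq φ = 1) (hψ : normSq ψ = 1)
    {T : Ket d → Set (Transformation d)} (hT : TEnsSLOCC ψ ⊆ T ψ) (hT' : T ψ ⊆ TEns ψ) :
    optimalFidelityFrom T ψ φ = protocolFidelity φ ψ := by
  rw [optimalFidelityFrom]
  have hmem {P : Protocol d} (hP : P.IsInvertible) : P.value (overlap φ) ψ ∈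
      {x | ∃ Λ ∈ T ψ, ∃ p χ, Λ.Yields ψ p χ ∧
        x = averageFidelity p (fun i => proj (χ i)) φ} := by
    obtain ⟨Λ, hΛ, h⟩ := exists_mem_TEnsSLOCC (φ := φ) hψ hP
    exact ⟨Λ, hT hΛ, h⟩
  refine csSup_eq_of_forall_le_of_forall_lt_exists_gt ⟨_, hmem (P := .halt) trivial⟩ ?_ ?_
  · rintro _ ⟨Λ, hΛ, p, χ, h, rfl⟩
    exact averageFidelity_le_protocolFidelity hφ hψ (hT' hΛ).1 h
  · intro c hc
    obtain ⟨P, hP⟩ := exists_lt_of_lt_ciSup hc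
    obtain ⟨P', hinv, hlt⟩ := Protocol.exists_isInvertible_lt_value (isGauge_overlap hφ) P ψ hP
    exact ⟨_, hmem hinv, hlt⟩

lemma isCompact_vicinity {ψ : Ket d} (hψ : IsPureState ψ) (δ : ℝ) :
    IsCompact (vicinity δ ψ) := by
  have heq : vicinity δ ψ = {v | normSq v = 1} ∩ {v | 1 - δ ≤ overlap ψ v} := by
    ext v
    simp only [vicinity, Set.mem_ofPred_eq, Set.mem_inter_iff, isPureState_iff,
      fidelityLU_proj hψ, overlap_comm v ψ]
  rw [heq]
  refine Metric.isCompact_of_isClosed_isBounded ?_ ?_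
  · exact (isClosed_eq continuous_normSq continuous_const).inter
      (isClosed_le continuous_const (isGauge_overlap ((isPureState_iff ψ).1 hψ)).continuous)
  · refine (Metric.isBounded_closedBall (x := (0 : Ket d)) (r := 1)).subset fun v hv => ?_
    rw [mem_closedBall_zero_iff, pi_norm_le_iff_of_nonneg zero_le_one]
    intro i
    have h : ‖v i‖ ^ 2 ≤ 1 := by
      rw [← show normSq v = 1 from hv.1]
      exact Finset.single_le_sum (f := fun i => ‖v i‖ ^ 2) (fun _ _ => by positivity)
        (Finset.mem_univ i)
    exact (sq_le_one_iff₀ (norm_nonneg _)).1 h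

end Optimal

end LOCC

end

/-- The optimal fidelities of general and of SLOCC-class-preserving LOCC ensemble transformations
coincide, and the maxima over the vicinity of the initial state that define them are attained. -/
theorem theorem4 {n : ℕ} (d : Fin n → ℕ) (ψ φ : LOCC.Ket d)
    (hψ : LOCC.IsPureState ψ) (hφ : LOCC.IsPureState φ) (δ : ℝ) (hδ : 0 ≤ δ) :
    LOCC.optimalFidelity LOCC.TEns δ ψ φ = LOCC.optimalFidelity LOCC.TEnsSLOCC δ ψ φ ∧
    IsGreatest (LOCC.fidelityValues LOCC.TEns δ ψ φ)
      (LOCC.optimalFidelity LOCC.TEns δ ψ φ) ∧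
    IsGreatest (LOCC.fidelityValues LOCC.TEnsSLOCC δ ψ φ)
      (LOCC.optimalFidelity LOCC.TEnsSLOCC δ ψ φ) := by
  have hφ1 := (LOCC.isPureState_iff φ).1 hφ
  have hψ1 := (LOCC.isPureState_iff ψ).1 hψ
  have hne : (LOCC.vicinity δ ψ).Nonempty := by
    refine ⟨ψ, hψ, ?_⟩
    rw [LOCC.fidelityLU_proj hψ]
    linarith [LOCC.overlap_self hψ1]
  have hsub (v : LOCC.Ket d) : LOCC.TEnsSLOCC v ⊆ LOCC.TEns v := fun _ h => h.1
  have hEns : LOCC.fidelityValues LOCC.TEns δ ψ φ =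
      LOCC.protocolFidelity φ '' LOCC.vicinity δ ψ :=
    Set.image_congr fun v hv => LOCC.optimalFidelityFrom_eq hφ1
      ((LOCC.isPureState_iff v).1 hv.1) (hsub v) subset_rfl
  have hSLOCC : LOCC.fidelityValues LOCC.TEnsSLOCC δ ψ φ =
      LOCC.protocolFidelity φ '' LOCC.vicinity δ ψ :=
    Set.image_congr fun v hv => LOCC.optimalFidelityFrom_eq hφ1
      ((LOCC.isPureState_iff v).1 hv.1) subset_rfl (hsub v)
  have hmax : IsGreatest (LOCC.protocolFidelity φ '' LOCC.vicinity δ ψ)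
      (sSup (LOCC.protocolFidelity φ '' LOCC.vicinity δ ψ)) :=
    ((LOCC.isCompact_vicinity hψ δ).image
      (LOCC.isGauge_protocolFidelity hφ1).continuous).isGreatest_sSup (hne.image _)
  rw [LOCC.optimalFidelity, LOCC.optimalFidelity, hEns, hSLOCC]
  exact ⟨rfl, hmax, hmax⟩
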